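/- **Theorem 1 (Gaplessness criteria).** Let $m\ge 0$, $p=(p^1,p^2,p^3)\in\mathbb R^3$, $p^0=\sqrt{m^2+|p|^2}$, and let $f^{eq}_p=e^{\alpha+\beta_\nu p^\nu}$ with real constants $\alpha,\beta_\nu$ such that $\beta_0<0$ and $\beta_1^2+\beta_2^2+\beta_3^2<\beta_0^2$. Let $\mathcal H$ be the complex Hilbert space $L^2(\mathbb R^3,f^{eq})$ with inner product $(\psi,\phi)=\int\frac{d^3p}{(2\pi)^3}f^{eq}_p\,\psi_p^*\phi_p$. Let $L$ be a linear operator, defined on a linear subspace of $\mathcal H$ and with values in the measurable functions on $\mathbb R^3$, such that $(p^0)^{-1}L$, on the states $\phi$ with $(p^0)^{-1}L\phi\in\mathcal H$, is a densely defined operator in $\mathcal H$ that is Hermitian and negative semidefinite: $((p^0)^{-1}L\psi,\phi)=(\psi,(p^0)^{-1}L\phi)$ and $(\phi,(p^0)^{-1}L\phi)\le 0$. Let $A$ be its Friedrichs extension, again denoted $(p^0)^{-1}L$. Put $\mathcal H_{\text{hy}}=\mathrm{span}\{1,p^0,p^1,p^2,p^3\}$ and $\mathcal H_{\text{non-hy}}=\mathcal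 H_{\text{hy}}^\perp$, and assume $\mathrm{Ker}(A)=\mathcal H_{\text{hy}}$. For $\phi$ in the domain $D(A)$ let $\varsigma=-(\phi,A\phi)$ be the entropy production, and let $E^0=\frac12\int\frac{d^3p}{(2\pi)^3p^0}f^{eq}_p\,p^0|\phi_p|^2$ be the free energy density. Then $A$ is the infinitesimal generator of a unique strongly continuous semigroup $(e^{tA})_{t\ge0}$ of bounded operators on $\mathcal H$, and the following are equivalent: (a) for every $t>0$, $\ \sup\{\|e^{tA}\phi\|/\|\phi\| : 0\ne\phi\in\mathcal H_{\text{non-hy}}\}=1$; (b) $\inf\{\|A\phi\|/\|\phi\| : 0\neq\phi\in\mathcal H_{\text{non-hy}}\cap D(A)\}=0$; (c) $\inf\{\varsigma/E^0 : 0\neq\phi\in\mathcal H_{\text{non-hy}}\cap D(A)\}=0$; (d) $0$ is an accumulation point of the spectrum of the restriction of $A$ to $\mathcal H_{\text{non-hy}}$: for every $\epsilon>0$ this spectrum contains a point $\lambda\ne0$ with $|\lambda|<\epsilon$. -/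

import Mathlib

open MeasureTheory Filter Topology
open scoped NNReal ENNReal InnerProductSpace

noncomputable section

namespace Gapless

section Operators

variable {H : Type*} [NormedAddCommGroup H] [InnerProductSpace ℂ H]

/-- The operator `S` is negative semidefinite: `Re ⟪x, S x⟫ ≤ 0` on its domain. -/
def NegSemidef (S : H →ₗ.[ℂ] H) : Prop :=
  ∀ x : S.domain, (⟪(x : H), S x⟫_ℂ).re ≤ 0

/-- The quadratic form `q(x) = -Re ⟪x, S x⟫` of `S`, on the domain of `S`. -/
def quadForm (S : H →ₗ.[ℂ] H) (x : S.domain) : ℝ := -(⟪(x : H), S x⟫_ℂ).re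

theorem quadForm_smul (S : H →ₗ.[ℂ] H) (c : ℂ) (x : S.domain) :
    quadForm S (c • x) = ‖c‖ ^ 2 * quadForm S x := by
  have h : ⟪((c • x : S.domain) : H), S (c • x)⟫_ℂ
      = ((‖c‖ ^ 2 : ℝ) : ℂ) * ⟪(x : H), S x⟫_ℂ := by
    rw [LinearPMap.map_smul, Submodule.coe_smul, inner_smul_left, inner_smul_right, ← mul_assoc,
      Complex.conj_mul']
    push_cast
    rfl
  simp only [quadForm, h, Complex.re_ofReal_mul]
  ring

theorem quadForm_add_le {S : H →ₗ.[ℂ] H} (hS : NegSemidef S) (x y : S.domain) :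
    quadForm S (x + y) ≤ 2 * quadForm S x + 2 * quadForm S y := by
  have h := hS (x - y)
  simp only [quadForm, LinearPMap.map_add, LinearPMap.map_sub, Submodule.coe_add,
    Submodule.coe_sub, inner_add_left, inner_add_right, inner_sub_left, inner_sub_right,
    Complex.add_re, Complex.sub_re] at h ⊢
  linarith

/-- The domain of the closure of the quadratic form of `S`: the limits in `H` of sequences in the
domain of `S` that are Cauchy for the form. -/
def formDomain (S : H →ₗ.[ℂ] H) (hS : NegSemidef S) : Submodule ℂ H where
  carrier := {x | ∃ u : ℕ → S.domain, Tendsto (fun n => (u n : H)) atTop (𝓝 x) ∧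
    ∀ ε > 0, ∃ N, ∀ i ≥ N, ∀ j ≥ N, quadForm S (u i - u j) < ε}
  zero_mem' := ⟨fun _ => 0, by simp, fun ε hε => ⟨0, fun _ _ _ _ => by simpa [quadForm] using hε⟩⟩
  add_mem' := by
    rintro x y ⟨u, hu, hu'⟩ ⟨v, hv, hv'⟩
    refine ⟨fun n => u n + v n, by simpa using hu.add hv, fun ε hε => ?_⟩
    obtain ⟨N, hN⟩ := hu' (ε / 4) (by positivity)
    obtain ⟨M, hM⟩ := hv' (ε / 4) (by positivity)
    refine ⟨max N M, fun i hi j hj => ?_⟩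
    have h1 := hN i (le_trans (le_max_left _ _) hi) j (le_trans (le_max_left _ _) hj)
    have h2 := hM i (le_trans (le_max_right _ _) hi) j (le_trans (le_max_right _ _) hj)
    have h3 := quadForm_add_le hS (u i - u j) (v i - v j)
    rw [add_sub_add_comm]
    linarith
  smul_mem' := by
    rintro c x ⟨u, hu, hu'⟩
    refine ⟨fun n => c • u n, by simpa using hu.const_smul c, fun ε hε => ?_⟩
    obtain ⟨N, hN⟩ := hu' (ε / (‖c‖ ^ 2 + 1)) (by positivity)
    refine ⟨N, fun i hi j hj => ?_⟩
    have h1 := hN i hi j hj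
    have h0 : 0 ≤ quadForm S (u i - u j) := neg_nonneg.2 (hS _)
    rw [lt_div_iff₀ (by positivity)] at h1
    rw [← smul_sub, quadForm_smul]
    nlinarith

/-- The Friedrichs extension of a (densely defined, Hermitian) negative semidefinite operator `S`:
the adjoint of `S`, restricted to the domain of the closed quadratic form of `S`. -/
def friedrichs [CompleteSpace H] (S : H →ₗ.[ℂ] H) (hS : NegSemidef S) : H →ₗ.[ℂ] H :=
  S.adjoint.domRestrict (formDomain S hS)

/-- The restriction of an operator `A` to a subspace `K`, as an operator in `K`: its domain consists
of the `x ∈ K` in the domain of `A` for which `A x ∈ K`. -/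
def restrict (A : H →ₗ.[ℂ] H) (K : Submodule ℂ H) : K →ₗ.[ℂ] K where
  domain :=
    { carrier := {x | ∃ h : (x : H) ∈ A.domain, A ⟨x, h⟩ ∈ K}
      zero_mem' := ⟨A.domain.zero_mem, by
        have : A ⟨((0 : K) : H), A.domain.zero_mem⟩ = 0 := A.map_zero
        rw [this]; exact K.zero_mem⟩
      add_mem' := by
        rintro x y ⟨hx, hx'⟩ ⟨hy, hy'⟩
        refine ⟨A.domain.add_mem hx hy, ?_⟩
        have := A.map_add ⟨x, hx⟩ ⟨y, hy⟩
        exact this ▸ K.add_mem hx' hy'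
      smul_mem' := by
        rintro c x ⟨hx, hx'⟩
        refine ⟨A.domain.smul_mem c hx, ?_⟩
        have := A.map_smul c ⟨x, hx⟩
        exact this ▸ K.smul_mem c hx' }
  toFun :=
    { toFun := fun x => ⟨A ⟨((x : K) : H), x.2.1⟩, x.2.2⟩
      map_add' := fun x y => Subtype.ext (A.map_add ⟨((x : K) : H), x.2.1⟩ ⟨((y : K) : H), y.2.1⟩)
      map_smul' := fun c x => Subtype.ext (A.map_smul c ⟨((x : K) : H), x.2.1⟩) }

/-- The resolvent set of an operator `A` in `H`: the `z` for which `z - A` is a bijection of the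
domain of `A` onto `H` with a bounded inverse `R`. -/
def resolventSet (A : H →ₗ.[ℂ] H) : Set ℂ :=
  {z | ∃ R : H →L[ℂ] H, (∀ x : H, ∃ h : R x ∈ A.domain, z • R x - A ⟨R x, h⟩ = x) ∧
    ∀ x : A.domain, R (z • (x : H) - A x) = x}

/-- The spectrum of an operator `A` in `H`. -/
def spectrum (A : H →ₗ.[ℂ] H) : Set ℂ := (resolventSet A)ᶜ

/-- `U t = e ^ (t A)`, `t ≥ 0`: `U` is a strongly continuous semigroup of bounded operators
whose infinitesimal generator (with its domain) is `A`. -/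
structure IsExponential (A : H →ₗ.[ℂ] H) (U : ℝ≥0 → H →L[ℂ] H) : Prop where
  zero : U 0 = 1
  add : ∀ s t, U (s + t) = U s * U t
  continuous : ∀ x, Continuous fun t => U t x
  generator : ∀ x y, (x, y) ∈ A.graph ↔
    Tendsto (fun t : ℝ≥0 => (t : ℝ)⁻¹ • (U t x - x)) (𝓝[≠] 0) (𝓝 y)

end Operators

/-- Momentum space `ℝ³`. -/
abbrev Momentum : Type := EuclideanSpace ℝ (Fin 3)

/-- The four-momentum `p^ν` of a particle of mass `m`, with `p^0 = √(m² + |p|²)`. -/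
def fourMomentum (m : ℝ) (p : Momentum) : Fin 4 → ℝ :=
  Fin.cons (√(m ^ 2 + ‖p‖ ^ 2)) fun i => p i

theorem measurable_energy (m : ℝ) : Measurable fun p : Momentum => fourMomentum m p 0 := by
  simp only [fourMomentum, Fin.cons_zero]
  fun_prop

/-- The equilibrium distribution `f_p = exp (α + β_ν p^ν)`. -/
def eqDist (m α : ℝ) (β : Fin 4 → ℝ) (p : Momentum) : ℝ :=
  Real.exp (α + ∑ ν, β ν * fourMomentum m p ν)

/-- The measure `f_p d³p / (2π)³` on momentum space. -/
def eqMeasure (m α : ℝ) (β : Fin 4 → ℝ) : Measure Momentum :=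
  volume.withDensity fun p => ENNReal.ofReal (eqDist m α β p / (2 * Real.pi) ^ 3)

/-- The Hilbert space `L²(ℝ³, f_p)` of complex-valued states. -/
abbrev StateSpace (m α : ℝ) (β : Fin 4 → ℝ) : Type := Lp ℂ 2 (eqMeasure m α β)

variable {m α : ℝ} {β : Fin 4 → ℝ}

/-- The function `1 / p^0`, up to almost everywhere equality. -/
def invEnergy (m α : ℝ) (β : Fin 4 → ℝ) : Momentum →ₘ[eqMeasure m α β] ℂ :=
  AEEqFun.mk (fun p => (((fourMomentum m p 0)⁻¹ : ℝ) : ℂ))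
    (Complex.measurable_ofReal.comp (measurable_energy m).inv).aestronglyMeasurable

/-- Multiplication by `1 / p^0` on functions modulo almost everywhere equality. -/
def divEnergy (m α : ℝ) (β : Fin 4 → ℝ) :
    (Momentum →ₘ[eqMeasure m α β] ℂ) →ₗ[ℂ] (Momentum →ₘ[eqMeasure m α β] ℂ) where
  toFun f := invEnergy m α β * f
  map_add' f g := by
    refine AEEqFun.ext ?_
    filter_upwards [AEEqFun.coeFn_mul (invEnergy m α β) (f + g), AEEqFun.coeFn_add f g,
      AEEqFun.coeFn_add (invEnergy m α β * f) (invEnergy m α β * g),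
      AEEqFun.coeFn_mul (invEnergy m α β) f, AEEqFun.coeFn_mul (invEnergy m α β) g]
      with p h1 h2 h3 h4 h5
    rw [h1, h3, Pi.mul_apply, h2, Pi.add_apply, Pi.add_apply, h4, h5, Pi.mul_apply, Pi.mul_apply,
      mul_add]
  map_smul' c f := by
    refine AEEqFun.ext ?_
    filter_upwards [AEEqFun.coeFn_mul (invEnergy m α β) (c • f), AEEqFun.coeFn_smul c f,
      AEEqFun.coeFn_smul c (invEnergy m α β * f), AEEqFun.coeFn_mul (invEnergy m α β) f]
      with p h1 h2 h3 h4
    rw [RingHom.id_apply, h1, h3, Pi.mul_apply, h2, Pi.smul_apply, Pi.smul_apply, h4, Pi.mul_apply,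
      mul_smul_comm]

/-- The operator `(p^0)⁻¹ L` in `L²(ℝ³, f_p)`, on the states `φ` in the domain of `L` for which
`(p^0)⁻¹ L φ` is square integrable. The values of `L` are functions modulo almost everywhere
equality, which need not be square integrable themselves. -/
def generator (L : StateSpace m α β →ₗ.[ℂ] (Momentum →ₘ[eqMeasure m α β] ℂ)) :
    StateSpace m α β →ₗ.[ℂ] StateSpace m α β where
  domain := ((Lp.LpSubmodule ℂ ℂ 2 (eqMeasure m α β)).comap
    ((divEnergy m α β).comp L.toFun)).map L.domain.subtype
  toFun :=
    { toFun := fun φ => ⟨divEnergy m α β (L ⟨φ, by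
          obtain ⟨x, _, hx⟩ := φ.2
          exact hx ▸ x.2⟩), by
        obtain ⟨_, x, hx, rfl⟩ := φ
        exact hx⟩
      map_add' := fun φ ψ => Subtype.ext <| by
        have := L.map_add ⟨φ, (by obtain ⟨x, _, hx⟩ := φ.2; exact hx ▸ x.2)⟩
          ⟨ψ, (by obtain ⟨x, _, hx⟩ := ψ.2; exact hx ▸ x.2)⟩
        exact (congrArg (divEnergy m α β) this).trans (map_add _ _ _)
      map_smul' := fun c φ => Subtype.ext <| by
        have := L.map_smul c ⟨φ, (by obtain ⟨x, _, hx⟩ := φ.2; exact hx ▸ x.2)⟩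
        exact (congrArg (divEnergy m α β) this).trans (map_smul _ _ _) }

/-- The space of hydrodynamic states: `span {1, p^ν}` in `L²(ℝ³, f_p)`. -/
def hydro (m α : ℝ) (β : Fin 4 → ℝ) : Submodule ℂ (StateSpace m α β) where
  carrier := {φ | ∃ (a : ℂ) (b : Fin 4 → ℂ),
    φ =ᵐ[eqMeasure m α β] fun p => a + ∑ ν, b ν * (fourMomentum m p ν : ℂ)}
  zero_mem' := ⟨0, 0, by
    filter_upwards [Lp.coeFn_zero ℂ 2 (eqMeasure m α β)] with p hp
    exact hp.trans (by simp)⟩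
  add_mem' := by
    rintro φ ψ ⟨a, b, h⟩ ⟨a', b', h'⟩
    refine ⟨a + a', b + b', ?_⟩
    filter_upwards [h, h', Lp.coeFn_add φ ψ] with p h1 h2 h3
    rw [h3, Pi.add_apply, h1, h2]
    simp only [Pi.add_apply, add_mul, Finset.sum_add_distrib]
    ring
  smul_mem' := by
    rintro c φ ⟨a, b, h⟩
    refine ⟨c * a, c • b, ?_⟩
    filter_upwards [h, Lp.coeFn_smul c φ] with p h1 h2
    rw [h2, Pi.smul_apply, h1]
    simp only [smul_eq_mul, Pi.smul_apply, mul_add, Finset.mul_sum, mul_assoc]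

/-- The space of non-hydrodynamic states: the orthogonal complement of `span {1, p^ν}`. -/
abbrev nonHydro (m α : ℝ) (β : Fin 4 → ℝ) : Submodule ℂ (StateSpace m α β) := (hydro m α β)ᗮ

/-- The information current `E^μ = ½ ∫ d³p / ((2π)³ p^0) f_p p^μ |φ_p|²`. -/
def infoCurrent (φ : StateSpace m α β) (μ : Fin 4) : ℝ :=
  1 / 2 * ∫ p : Momentum, eqDist m α β p / ((2 * Real.pi) ^ 3 * fourMomentum m p 0) *
    fourMomentum m p μ * ‖φ p‖ ^ 2

/-- The entropy production `ς = -Re (φ, A φ)` of a state `φ` in the domain of `A = (p^0)⁻¹ L`. -/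
def entropyProduction (A : StateSpace m α β →ₗ.[ℂ] StateSpace m α β) (φ : A.domain) : ℝ :=
  -(⟪(φ : StateSpace m α β), A φ⟫_ℂ).re

end Gapless

end

/-!
# Gaplessness criteria for a relativistic kinetic equation

The proof works with the bounded resolvent `R = (1 - A)⁻¹` instead of the unbounded operator `A`.

The Friedrichs extension `A` of a densely defined, Hermitian, negative semidefinite operator has the
resolvent `R = J J†`, where `J` maps the completion of the domain for the form inner product to the
Hilbert space (`exists_isNegResolvent_friedrichs`). Then `R` is self-adjoint and injective,
`0 ≤ R ≤ 1`, and `A R w = R w - w`; this determines `A`, and everything else follows from these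
facts, which are collected in `IsNegResolvent`.

The point `-s` of the spectrum of `A` corresponds to the point `x = (1 + s)⁻¹` of the spectrum of `R`,
so `exp (t A)` is the function `exp (-t (x⁻¹ - 1))` of `R`, which is continuous on `[0, 1]` when
`t > 0`. Estimates of this function show that it is a strongly continuous contraction semigroup with
generator `A` (`IsNegResolvent.isExponential`). It is the only one, since
`s ↦ V (T - s) (U s x)` has right derivative `0` for two semigroups `U`, `V` with the same generator
(`IsExponential.unique`).

For the equivalences (`tfae_gapless`), let `K` be the complement of the kernel of `A`, which reduces
`R`. All four conditions say that `1 - R` is not bounded below on `K`.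
* (b) implies (c) by the Cauchy-Schwarz inequality.
* (c) implies (a) by `⟪φ, exp (t A) φ⟫ ≥ ‖φ‖² + t ⟪φ, A φ⟫` (`le_re_inner_semigroup`).
* (a) implies (b) by `‖exp (A / 2) φ‖² ≤ ⟪φ, R φ⟫` (`norm_semigroup_half_sq_le`).
* (d) implies (b) because the resolvent set is open: `z - A = (1 - (1 - z) R) R⁻¹`, so that a bound
  below for `1 - R` on `K` gives a neighbourhood of `0` free of spectrum.
* (b) implies (d) because an isolated point `0` of the spectrum would be an eigenvalue, and `A` is
  injective on `K` (`isUnit_one_sub_of_isolated`).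

The free energy density equals `‖φ‖² / 2` (`infoCurrent_zero`), which gives (c) its form above.
-/

namespace Gapless

/-! ### The Friedrichs extension -/

section Friedrichs

variable {H : Type*} [NormedAddCommGroup H] [InnerProductSpace ℂ H]

/-- The form inner product `⟪x, y⟫ - ⟪x, S y⟫` on the domain of `S`, whose squared norm is
`‖x‖² + q(x)`. -/
noncomputable abbrev formCore (S : H →ₗ.[ℂ] H) (hS : NegSemidef S) (hsymm : S.IsFormalAdjoint S) :
    InnerProductSpace.Core ℂ S.domain where
  inner x y := ⟪(x : H), (y : H)⟫_ℂ - ⟪(x : H), S y⟫_ℂ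
  conj_inner_symm x y := by
    rw [map_sub, inner_conj_symm, inner_conj_symm, hsymm]
  re_inner_nonneg x := by
    have h1 := hS x
    have h2 : 0 ≤ (⟪(x : H), (x : H)⟫_ℂ).re := inner_self_nonneg (𝕜 := ℂ)
    simp only [RCLike.re_to_complex, Complex.sub_re]
    linarith
  add_left x y z := by
    simp only [Submodule.coe_add, inner_add_left]
    ring
  smul_left x y r := by
    simp only [Submodule.coe_smul, inner_smul_left]
    ring
  definite x hx := by
    have h1 := hS x
    have h2 := congrArg Complex.re hx
    have h3 : (⟪(x : H), (x : H)⟫_ℂ).re = ‖(x : H)‖ ^ 2 := (norm_sq_eq_re_inner (𝕜 := ℂ) _).symm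
    simp only [Complex.sub_re, h3, Complex.zero_re] at h2
    have h4 : ‖(x : H)‖ ^ 2 = 0 := le_antisymm (by linarith) (by positivity)
    simpa using h4

theorem formCore_inner_self (S : H →ₗ.[ℂ] H) (hS : NegSemidef S) (hsymm : S.IsFormalAdjoint S)
    (x : S.domain) :
    ((formCore S hS hsymm).inner x x).re = ‖(x : H)‖ ^ 2 + quadForm S x := by
  have h3 : (⟪(x : H), (x : H)⟫_ℂ).re = ‖(x : H)‖ ^ 2 := (norm_sq_eq_re_inner (𝕜 := ℂ) _).symm
  have h4 : ((formCore S hS hsymm).inner x x).re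
      = (⟪(x : H), (x : H)⟫_ℂ).re - (⟪(x : H), S x⟫_ℂ).re := Complex.sub_re _ _
  rw [h4, h3, quadForm, sub_eq_add_neg]

/-- A vector of the form domain that is orthogonal to the range of `1 - S` vanishes. This is where
the restriction to the form domain is needed: the adjoint of `S` alone may have further solutions
of `S† x = x`. -/
theorem eq_zero_of_mem_formDomain {S : H →ₗ.[ℂ] H} {hS : NegSemidef S}
    (hsymm : S.IsFormalAdjoint S) {x : H} (hx : x ∈ formDomain S hS)
    (h : ∀ z : S.domain, ⟪x, (z : H) - S z⟫_ℂ = 0) : x = 0 := by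
  obtain ⟨u, hu, hc⟩ := hx
  -- With `Q` the form norm squared, `‖u i‖² ≤ Q (u i - u k) + 2 Re ⟪u i, u k⟫` in the form inner
  -- product; the last term tends to `0` for fixed `k`.
  have key : ∀ i k : ℕ, ‖(u i : H)‖ ^ 2 ≤ ‖(u i : H) - u k‖ ^ 2 + quadForm S (u i - u k)
      + 2 * (⟪(u i : H), (u k : H) - S (u k)⟫_ℂ).re := fun i k => by
    have h1 : ‖(u i : H) - u k‖ ^ 2 = ‖(u i : H)‖ ^ 2 - 2 * (⟪(u i : H), (u k : H)⟫_ℂ).re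
        + ‖(u k : H)‖ ^ 2 := norm_sub_sq (𝕜 := ℂ) _ _
    have h4 : 0 ≤ quadForm S (u i) := neg_nonneg.2 (hS _)
    have h5 : 0 ≤ quadForm S (u k) := neg_nonneg.2 (hS _)
    have h7 : (⟪(u k : H), S (u i)⟫_ℂ).re = (⟪(u i : H), S (u k)⟫_ℂ).re := by
      rw [← hsymm]
      exact inner_re_symm (𝕜 := ℂ) _ _
    have h8 : (0 : ℝ) ≤ ‖(u k : H)‖ ^ 2 := by positivity
    simp only [quadForm, LinearPMap.map_sub, Submodule.coe_sub, inner_sub_left,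
      inner_sub_right, Complex.sub_re] at h4 h5 ⊢
    linarith
  have hlim : ∀ ε > 0, ‖x‖ ^ 2 ≤ ε := fun ε hε => by
    obtain ⟨N, hN⟩ := hc (ε / 2) (by positivity)
    obtain ⟨M, hM⟩ := Metric.cauchySeq_iff.1 hu.cauchySeq (√(ε / 2)) (Real.sqrt_pos.2 (by positivity))
    let k := max N M
    have h1 : Tendsto (fun i => ‖(u i : H)‖ ^ 2) atTop (𝓝 (‖x‖ ^ 2)) := hu.norm.pow 2
    have h2 : Tendsto (fun i => ε + 2 * (⟪(u i : H), (u k : H) - S (u k)⟫_ℂ).re) atTop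
        (𝓝 (ε + 2 * (⟪x, (u k : H) - S (u k)⟫_ℂ).re)) :=
      ((Complex.continuous_re.tendsto _).comp (hu.inner tendsto_const_nhds)).const_mul 2
        |>.const_add ε
    rw [h, Complex.zero_re, mul_zero, add_zero] at h2
    refine le_of_tendsto_of_tendsto h1 h2 ?_
    filter_upwards [eventually_ge_atTop k] with i hi
    have h3 := hN i ((le_max_left _ _).trans hi) k (le_max_left _ _)
    have h4 := hM i ((le_max_right _ _).trans hi) k (le_max_right _ _)
    rw [dist_eq_norm, Real.lt_sqrt (norm_nonneg _)] at h4
    linarith [key i k]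
  have : ‖x‖ ^ 2 ≤ 0 := le_of_forall_pos_le_add fun ε hε => by simpa using hlim ε hε
  simpa using le_antisymm this (by positivity)

variable [CompleteSpace H]

/-- If `J` is the extension of `j` to the completion of `V`, then `R = J J†`: the vector `J† w`
represents the functional `v ↦ ⟪w, j v⟫` in the inner product of the completion, and `u` is a
sequence in `V` that approximates it. -/
theorem exists_resolvent_of_form_aux {V : Type*} [NormedAddCommGroup V] [InnerProductSpace ℂ V]
    (j : V →L[ℂ] H) (hj : ∀ v, ‖j v‖ ≤ ‖v‖) :
    ∃ R : H →L[ℂ] H, IsSelfAdjoint R ∧ (∀ w, ‖R w‖ ^ 2 ≤ (⟪R w, w⟫_ℂ).re) ∧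
      ∀ w, ∃ u : ℕ → V, Tendsto (fun n => j (u n)) atTop (𝓝 (R w)) ∧ CauchySeq u ∧
        ∀ v, Tendsto (fun n => ⟪u n, v⟫_ℂ) atTop (𝓝 ⟪w, j v⟫_ℂ) := by
  let W := UniformSpace.Completion V
  let e : V →L[ℂ] W := UniformSpace.Completion.toComplL
  have hed : DenseRange e := UniformSpace.Completion.denseRange_coe
  have heu : IsUniformInducing e := UniformSpace.Completion.isUniformInducing_coe V
  let J : W →L[ℂ] H := j.extend e
  have hJe : ∀ v, J (e v) = j v := j.extend_eq hed heu
  have hJ : ∀ ξ, ‖J ξ‖ ≤ ‖ξ‖ := fun ξ => by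
    refine hed.induction_on ξ (isClosed_le (by fun_prop) (by fun_prop)) fun v => ?_
    rw [hJe]
    exact (hj v).trans_eq (UniformSpace.Completion.norm_coe v).symm
  refine ⟨J ∘L J.adjoint, ?_, fun w => ?_, fun w => ?_⟩
  · exact (ContinuousLinearMap.isPositive_self_comp_adjoint J).isSelfAdjoint
  · rw [ContinuousLinearMap.comp_apply, ← ContinuousLinearMap.adjoint_inner_right,
      inner_self_eq_norm_sq_to_K]
    have := hJ (J.adjoint w)
    norm_cast
    exact pow_le_pow_left₀ (norm_nonneg _) this 2
  · obtain ⟨x, hx, hu⟩ := mem_closure_iff_seq_limit.1 (hed (J.adjoint w))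
    choose u hux using hx
    obtain rfl : (fun n => e (u n)) = x := funext hux
    refine ⟨u, ?_, ?_, fun v => ?_⟩
    · have h := (J.continuous.tendsto _).comp hu
      simp only [Function.comp_def, hJe] at h
      exact h
    · refine heu.cauchy_map_iff.1 ?_
      rw [Filter.map_map]
      exact hu.cauchySeq
    · have h : Tendsto (fun n => ⟪e (u n), e v⟫_ℂ) atTop (𝓝 ⟪J.adjoint w, e v⟫_ℂ) :=
        hu.inner tendsto_const_nhds
      rw [ContinuousLinearMap.adjoint_inner_left, hJe] at h
      exact h.congr fun n => UniformSpace.Completion.inner_coe _ _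

/-- The resolvent of the operator associated with a form `c` on a vector space `V` mapped to `H`: the
vector `R w` is the image of the solution `u` of `c (u, v) = ⟪w, j v⟫` in the completion of `V`. The
inner product is passed as a term since `V` is to be a subspace of `H`, which has its own. -/
theorem exists_resolvent_of_form {V : Type*} [AddCommGroup V] [Module ℂ V]
    (c : InnerProductSpace.Core ℂ V) (j : V →ₗ[ℂ] H)
    (hj : ∀ v, ‖j v‖ ^ 2 ≤ (c.inner v v).re) :
    ∃ R : H →L[ℂ] H, IsSelfAdjoint R ∧ (∀ w, ‖R w‖ ^ 2 ≤ (⟪R w, w⟫_ℂ).re) ∧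
      ∀ w, ∃ u : ℕ → V, Tendsto (fun n => j (u n)) atTop (𝓝 (R w)) ∧
        (∀ ε > 0, ∃ N, ∀ i ≥ N, ∀ k ≥ N, (c.inner (u i - u k) (u i - u k)).re < ε) ∧
        ∀ v, Tendsto (fun n => c.inner (u n) v) atTop (𝓝 ⟪w, j v⟫_ℂ) := by
  let : NormedAddCommGroup V := c.toNormedAddCommGroup
  let : InnerProductSpace ℂ V := InnerProductSpace.ofCore c.toCore
  have hn : ∀ v : V, ‖v‖ ^ 2 = (c.inner v v).re := fun v => norm_sq_eq_re_inner (𝕜 := ℂ) v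
  have hj' : ∀ v, ‖j v‖ ≤ 1 * ‖v‖ := fun v => by
    rw [one_mul]
    exact (sq_le_sq₀ (norm_nonneg _) (norm_nonneg _)).1 ((hj v).trans_eq (hn v).symm)
  obtain ⟨R, h1, h2, h3⟩ := exists_resolvent_of_form_aux (j.mkContinuous 1 hj')
    (fun v => (hj' v).trans_eq (one_mul _))
  refine ⟨R, h1, h2, fun w => ?_⟩
  obtain ⟨u, hu, hc, hv⟩ := h3 w
  refine ⟨u, hu, fun ε hε => ?_, hv⟩
  obtain ⟨N, hN⟩ := Metric.cauchySeq_iff.1 hc (√ε) (Real.sqrt_pos.2 hε)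
  refine ⟨N, fun i hi k hk => ?_⟩
  rw [← hn, ← Real.lt_sqrt (norm_nonneg _), ← dist_eq_norm]
  exact hN i hi k hk

/-- `R` is the resolvent `(1 - A)⁻¹` of a nonpositive self-adjoint operator `A`: it is bounded and
self-adjoint, satisfies `R² ≤ R`, and `A x = y` holds exactly when `R (x - y) = x`. -/
structure IsNegResolvent (A : H →ₗ.[ℂ] H) (R : H →L[ℂ] H) : Prop where
  isSelfAdjoint : IsSelfAdjoint R
  norm_sq_le : ∀ w, ‖R w‖ ^ 2 ≤ (⟪R w, w⟫_ℂ).re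
  mem_graph : ∀ x y, (x, y) ∈ A.graph ↔ R (x - y) = x

/-- The Friedrichs extension of a densely defined, Hermitian, negative semidefinite operator is a
nonpositive self-adjoint operator, given by its resolvent. The Riesz representative of `⟪w, ·⟫` in
the completion of the form domain solves `(1 - S†) x = w` weakly, and lies in the form domain. -/
theorem exists_isNegResolvent_friedrichs (S : H →ₗ.[ℂ] H) (hS : NegSemidef S)
    (hdense : Dense (S.domain : Set H)) (hsymm : S.IsFormalAdjoint S) :
    ∃ R : H →L[ℂ] H, IsNegResolvent (friedrichs S hS) R := by
  obtain ⟨R, h1, h2, h3⟩ := exists_resolvent_of_form (formCore S hS hsymm) S.domain.subtype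
    (fun v => by
      rw [formCore_inner_self]
      have : 0 ≤ quadForm S v := neg_nonneg.2 (hS _)
      simpa using this)
  -- The graph of the Friedrichs extension, with `S†` characterized by its weak formulation.
  have hgraph : ∀ x y, (x, y) ∈ (friedrichs S hS).graph ↔
      x ∈ formDomain S hS ∧ ∀ z : S.domain, ⟪y, (z : H)⟫_ℂ = ⟪x, S z⟫_ℂ := fun x y => by
    rw [LinearPMap.mem_graph_iff]
    constructor
    · rintro ⟨⟨_, hx1, hx2⟩, rfl, rfl⟩
      exact ⟨hx1, fun z => LinearPMap.adjoint_isFormalAdjoint hdense ⟨_, hx2⟩ z⟩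
    · rintro ⟨hx, h⟩
      have hx2 := S.mem_adjoint_domain_of_exists x ⟨y, h⟩
      exact ⟨⟨x, hx, hx2⟩, rfl, LinearPMap.adjoint_apply_eq hdense ⟨x, hx2⟩ h⟩
  have hR : ∀ w, R w ∈ formDomain S hS ∧
      ∀ z : S.domain, ⟪R w, (z : H) - S z⟫_ℂ = ⟪w, (z : H)⟫_ℂ := fun w => by
    obtain ⟨u, hu, hc, hv⟩ := h3 w
    refine ⟨⟨u, hu, fun ε hε => ?_⟩, fun z => ?_⟩
    · obtain ⟨N, hN⟩ := hc ε hε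
      refine ⟨N, fun i hi k hk => lt_of_le_of_lt ?_ (hN i hi k hk)⟩
      rw [formCore_inner_self]
      exact le_add_of_nonneg_left (by positivity)
    · refine tendsto_nhds_unique ?_ (hv z)
      have : Tendsto (fun n => ⟪(u n : H), (z : H) - S z⟫_ℂ) atTop (𝓝 ⟪R w, (z : H) - S z⟫_ℂ) :=
        Tendsto.inner hu tendsto_const_nhds
      simp only [inner_sub_right] at this ⊢
      exact this
  refine ⟨R, h1, h2, fun x y => ?_⟩
  rw [hgraph]
  constructor
  · rintro ⟨hx, h⟩
    obtain ⟨hw, hw'⟩ := hR (x - y)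
    refine (sub_eq_zero.1 <| eq_zero_of_mem_formDomain hsymm
      ((formDomain S hS).sub_mem hw hx) fun z => ?_)
    rw [inner_sub_left, hw', inner_sub_left, inner_sub_right, h]
    ring
  · intro h
    obtain ⟨hw, hw'⟩ := hR (x - y)
    rw [h] at hw hw'
    refine ⟨hw, fun z => ?_⟩
    have := hw' z
    rw [inner_sub_left, inner_sub_right] at this
    exact (sub_right_injective this).symm

end Friedrichs

/-! ### The functions that define the semigroup -/

section Decay

/-- The function `x ↦ exp (-t (x⁻¹ - 1))` for `t > 0`, extended by `0` to `x ≤ 0`. It turns the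
resolvent `(1 - A)⁻¹` into `exp (t A)`. -/
noncomputable def decay (t x : ℝ) : ℝ := Real.exp t * expNegInvGlue (x / t)

theorem continuous_decay (t : ℝ) : Continuous (decay t) :=
  continuous_const.mul ((expNegInvGlue.contDiff (n := 0)).continuous.comp (continuous_id.div_const t))

theorem decay_zero_right (t : ℝ) : decay t 0 = 0 := by simp [decay]

theorem decay_of_pos {t x : ℝ} (ht : 0 < t) (hx : 0 < x) :
    decay t x = Real.exp (-(t * (x⁻¹ - 1))) := by
  rw [decay, expNegInvGlue, if_neg (by positivity : 0 < x / t).not_ge, ← Real.exp_add]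
  congr 1
  rw [inv_div]
  ring

theorem decay_add {s t x : ℝ} (hs : 0 < s) (ht : 0 < t) (hx : 0 ≤ x) :
    decay (s + t) x = decay s x * decay t x := by
  rcases hx.eq_or_lt with rfl | hx
  · simp [decay_zero_right]
  · rw [decay_of_pos (by positivity) hx, decay_of_pos hs hx, decay_of_pos ht hx, ← Real.exp_add]
    ring_nf

theorem decay_nonneg (t x : ℝ) : 0 ≤ decay t x :=
  mul_nonneg (Real.exp_pos _).le (expNegInvGlue.nonneg _)

variable {t x : ℝ}

theorem decay_le_one (ht : 0 < t) (hx : 0 ≤ x) (hx1 : x ≤ 1) : decay t x ≤ 1 := by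
  rcases hx.eq_or_lt with rfl | hx
  · simp [decay_zero_right]
  · rw [decay_of_pos ht hx, Real.exp_le_one_iff, neg_nonpos]
    exact mul_nonneg ht.le (sub_nonneg.2 ((one_le_inv₀ hx).2 hx1))

theorem one_sub_decay_mul_le (ht : 0 < t) (hx : 0 ≤ x) (hx1 : x ≤ 1) :
    (1 - decay t x) * x ≤ t * (1 - x) := by
  rcases hx.eq_or_lt with rfl | hx
  · simpa using ht.le
  · rw [decay_of_pos ht hx]
    have h := Real.add_one_le_exp (-(t * (x⁻¹ - 1)))
    calc (1 - Real.exp (-(t * (x⁻¹ - 1)))) * x ≤ (t * (x⁻¹ - 1)) * x := by gcongr; linarith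
      _ = t * (1 - x) := by field_simp

theorem exp_neg_le_inv_one_add {u : ℝ} (hu : 0 ≤ u) : Real.exp (-u) ≤ (1 + u)⁻¹ := by
  rw [Real.exp_neg]
  exact inv_anti₀ (by positivity) (by linarith [Real.add_one_le_exp u])

theorem decay_one_le (hx : 0 ≤ x) (hx1 : x ≤ 1) : decay 1 x ≤ x := by
  rcases hx.eq_or_lt with rfl | hx
  · simp [decay_zero_right]
  · rw [decay_of_pos one_pos hx]
    refine (exp_neg_le_inv_one_add ?_).trans_eq ?_
    · rw [one_mul]
      exact sub_nonneg.2 ((one_le_inv₀ hx).2 hx1)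
    · simp

/-- The difference quotient `t⁻¹ (decay t x - 1)` differs from its limit `1 - x⁻¹` by at most
`t (1 - x⁻¹)²`; a factor `x²` makes the bound uniform on `[0, 1]`. -/
theorem abs_decay_quotient_le (ht : 0 < t) (hx : 0 ≤ x) (hx1 : x ≤ 1) :
    |(t⁻¹ * ((decay t x - 1) * x) - (x - 1)) * x| ≤ t := by
  rcases hx.eq_or_lt with rfl | hx
  · simpa using ht.le
  · rw [decay_of_pos ht hx]
    set u := t * (x⁻¹ - 1) with hu
    have hu0 : 0 ≤ u := mul_nonneg ht.le (sub_nonneg.2 ((one_le_inv₀ hx).2 hx1))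
    have h1 : 0 ≤ Real.exp (-u) - 1 + u := by linarith [Real.add_one_le_exp (-u)]
    have h2 : Real.exp (-u) - 1 + u ≤ u ^ 2 := by
      have h3 := exp_neg_le_inv_one_add hu0
      have h4 : (1 + u)⁻¹ ≤ 1 - u + u ^ 2 := by
        rw [inv_le_iff_one_le_mul₀ (by positivity)]
        nlinarith [pow_nonneg hu0 3]
      linarith
    have hxu : x * u = t * (1 - x) := by rw [hu]; field_simp
    have h5 : (t⁻¹ * ((Real.exp (-u) - 1) * x) - (x - 1)) * x
        = t⁻¹ * (x ^ 2 * (Real.exp (-u) - 1 + u)) := by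
      have : x - 1 = - (t⁻¹ * (x * u)) := by rw [hxu]; field_simp; ring
      rw [this]
      ring
    rw [h5, abs_of_nonneg (by positivity)]
    calc t⁻¹ * (x ^ 2 * (Real.exp (-u) - 1 + u)) ≤ t⁻¹ * (x ^ 2 * u ^ 2) := by gcongr
      _ = t⁻¹ * (t * (1 - x)) ^ 2 := by rw [← hxu]; ring
      _ = t * (1 - x) ^ 2 := by field_simp
      _ ≤ t * 1 := by gcongr; exact pow_le_one₀ (by linarith) (by linarith)
      _ = t := mul_one t

end Decay

/-! ### Existence and uniqueness of the semigroup -/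

section Semigroup

variable {H : Type*} [NormedAddCommGroup H] [InnerProductSpace ℂ H]

/-- A uniformly bounded family of operators that tends to `0` on a dense subspace tends strongly
to `0`. -/
theorem tendsto_apply_zero_of_denseRange {ι : Type*} {l : Filter ι} {F : ι → H →L[ℂ] H} {C : ℝ}
    {b : ι → ℝ} {R : H →L[ℂ] H} (hR : DenseRange R) (hb : Tendsto b l (𝓝 0))
    (hC : ∀ᶠ t in l, ‖F t‖ ≤ C) (h : ∀ᶠ t in l, ∀ w, ‖F t (R w)‖ ≤ b t * ‖w‖) (y : H) :
    Tendsto (fun t => F t y) l (𝓝 0) := by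
  rw [Metric.tendsto_nhds]
  intro ε hε
  obtain ⟨w, hw⟩ := hR.exists_dist_lt y (show 0 < ε / (2 * (|C| + 1)) by positivity)
  have h1 : ∀ᶠ t in l, b t * ‖w‖ < ε / 2 := by
    have : Tendsto (fun t => b t * ‖w‖) l (𝓝 (0 * ‖w‖)) := hb.mul_const _
    rw [zero_mul] at this
    exact this.eventually_lt_const (by positivity)
  filter_upwards [h1, hC, h] with t h1 h2 h3
  rw [dist_zero_right]
  rw [dist_eq_norm, lt_div_iff₀ (by positivity)] at hw
  have h4 : ‖F t (y - R w)‖ ≤ (|C| + 1) * ‖y - R w‖ :=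
    ((F t).le_opNorm _).trans (by gcongr; linarith [le_abs_self C])
  calc ‖F t y‖ = ‖F t (y - R w) + F t (R w)‖ := by rw [← map_add, sub_add_cancel]
    _ ≤ ‖F t (y - R w)‖ + ‖F t (R w)‖ := norm_add_le _ _
    _ < ε := by linarith [h3 w]

variable {A : H →ₗ.[ℂ] H} {U V : ℝ≥0 → H →L[ℂ] H}

/-- The semigroup maps the graph of its generator to itself. -/
theorem IsExponential.map_mem_graph (hU : IsExponential A U) (s : ℝ≥0) {x y : H}
    (h : (x, y) ∈ A.graph) : (U s x, U s y) ∈ A.graph := by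
  rw [hU.generator] at h ⊢
  refine (((U s).continuous.tendsto y).comp h).congr fun t => ?_
  have : U t (U s x) = U s (U t x) := by
    rw [← mul_apply_eq_comp, ← mul_apply_eq_comp, ← hU.add, ← hU.add,
      add_comm]
  rw [Function.comp_apply, this, ← map_sub]
  exact (U s).map_smul_of_tower _ _

variable [CompleteSpace H]

/-- Strongly continuous semigroups are bounded on compact time intervals (Banach-Steinhaus). -/
theorem IsExponential.exists_norm_le (hU : IsExponential A U) (T : ℝ≥0) :
    ∃ M, 0 ≤ M ∧ ∀ t ≤ T, ‖U t‖ ≤ M := by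
  obtain ⟨M, hM⟩ := banach_steinhaus (g := fun t : Set.Icc 0 T => U t) fun x => by
    obtain ⟨C, hC⟩ := (isCompact_Icc (a := 0) (b := T)).exists_bound_of_continuousOn
      (hU.continuous x).continuousOn
    exact ⟨C, fun t => hC t t.2⟩
  exact ⟨M, (norm_nonneg _).trans (hM ⟨0, by simp⟩), fun t ht => hM ⟨t, by simp, ht⟩⟩

/-- Joint continuity of `(t, y) ↦ U t y` on bounded time intervals. -/
theorem IsExponential.tendsto_apply {ι : Type*} {l : Filter ι} (hU : IsExponential A U) {T : ℝ≥0}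
    {τ : ι → ℝ≥0} (hτT : ∀ i, τ i ≤ T) {y : ι → H} {τ₀ : ℝ≥0} {y₀ : H} (hτ : Tendsto τ l (𝓝 τ₀))
    (hy : Tendsto y l (𝓝 y₀)) : Tendsto (fun i => U (τ i) (y i)) l (𝓝 (U τ₀ y₀)) := by
  obtain ⟨M, -, hM⟩ := hU.exists_norm_le T
  have h1 : Tendsto (fun i => U (τ i) y₀) l (𝓝 (U τ₀ y₀)) := ((hU.continuous y₀).tendsto _).comp hτ
  have h2 : Tendsto (fun i => U (τ i) (y i - y₀)) l (𝓝 0) := by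
    refine squeeze_zero_norm (a := fun i => M * ‖y i - y₀‖) (fun i => ?_) ?_
    · exact ((U (τ i)).le_opNorm _).trans (by gcongr; exact hM _ (hτT i))
    · simpa using ((hy.sub_const y₀).norm).const_mul M
  simpa using h2.add h1

/-- A strongly continuous semigroup is determined by its generator: for `x` in the domain, the
function `s ↦ V (T - s) (U s x)` has right derivative `0`, hence is constant on `[0, T]`. -/
theorem IsExponential.unique (hA : Dense (A.domain : Set H)) (hU : IsExponential A U)
    (hV : IsExponential A V) : V = U := by
  refine funext fun T => ContinuousLinearMap.ext_on (s := (A.domain : Set H))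
    (hA.mono Submodule.subset_span) fun x hx => ?_
  let w : ℝ → H := fun s => V (T - s).toNNReal (U s.toNNReal x)
  have hle : ∀ s ∈ Set.Icc 0 (T : ℝ), (T - s : ℝ).toNNReal ≤ T := fun s hs =>
    Real.toNNReal_le_iff_le_coe.2 (by linarith [hs.1])
  have hcont : ContinuousOn w (Set.Icc 0 (T : ℝ)) := by
    rw [continuousOn_iff_continuous_domRestrict, continuous_iff_continuousAt]
    intro s
    refine hV.tendsto_apply (T := T) (τ := fun s : Set.Icc 0 (T : ℝ) => (T - s : ℝ).toNNReal)
      (fun s => hle s s.2) ?_ ?_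
    · exact Continuous.tendsto (by fun_prop) s
    · exact Continuous.tendsto ((hU.continuous x).comp (by fun_prop)) s
  have hderiv : ∀ s ∈ Set.Ico 0 (T : ℝ), HasDerivWithinAt w 0 (Set.Ici s) s := by
    intro s hs
    rw [← hasDerivWithinAt_Ioi_iff_Ici, hasDerivWithinAt_iff_tendsto_slope' (by simp)]
    obtain ⟨y, hy⟩ := A.mem_domain_iff.1 hx
    have hg := hU.map_mem_graph s.toNNReal hy
    obtain ⟨M, hM0, hM⟩ := hV.exists_norm_le T
    have hτ : Tendsto (fun s' => (s' - s).toNNReal) (𝓝[>] s) (𝓝[≠] 0) := by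
      refine tendsto_nhdsWithin_iff.2 ⟨?_, ?_⟩
      · have : Tendsto (fun s' => (s' - s).toNNReal) (𝓝 s) (𝓝 (s - s).toNNReal) :=
          Continuous.tendsto (by fun_prop) s
        rw [sub_self, Real.toNNReal_zero] at this
        exact this.mono_left nhdsWithin_le_nhds
      · filter_upwards [self_mem_nhdsWithin] with s' hs'
        simpa using hs'
    have hlim := ((((hU.generator _ _).1 hg).comp hτ).sub (((hV.generator _ _).1 hg).comp hτ)).norm
    rw [sub_self, norm_zero] at hlim
    refine squeeze_zero_norm' ?_ (by simpa using hlim.const_mul M)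
    filter_upwards [Ioo_mem_nhdsGT hs.2] with s' hs'
    have h0 : 0 < s' - s := sub_pos.2 hs'.1
    have e1 : (T - s : ℝ).toNNReal = (T - s' : ℝ).toNNReal + (s' - s).toNNReal := by
      rw [← Real.toNNReal_add (by linarith [hs'.2]) h0.le]
      congr 1
      ring
    have e2 : s'.toNNReal = (s' - s).toNNReal + s.toNNReal := by
      rw [← Real.toNNReal_add h0.le hs.1]
      congr 1
      ring
    have e3 : slope w s s' = V (T - s' : ℝ).toNNReal
        (((s' - s).toNNReal : ℝ)⁻¹ • (U (s' - s).toNNReal (U s.toNNReal x) - U s.toNNReal x)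
          - ((s' - s).toNNReal : ℝ)⁻¹ • (V (s' - s).toNNReal (U s.toNNReal x) - U s.toNNReal x)) := by
      rw [← smul_sub, sub_sub_sub_cancel_right,
        ContinuousLinearMap.map_smul_of_tower, map_sub, slope_def_module, Real.coe_toNNReal _ h0.le]
      simp only [w]
      rw [e1, hV.add, e2, hU.add]
      rfl
    rw [e3]
    refine ((V _).le_opNorm _).trans ?_
    gcongr
    · exact hM _ (hle s' ⟨hs.1.trans hs'.1.le, hs'.2.le⟩)
    · rfl
  have h := constant_of_has_deriv_right_zero hcont hderiv T ⟨T.2, le_rfl⟩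
  simpa [w, hU.zero, hV.zero] using h.symm

/-- The semigroup `exp (t A)`, as a function of the resolvent `R = (1 - A)⁻¹`. The case `t = 0` is
separate because `decay 0 = 0`. -/
noncomputable def semigroup (R : H →L[ℂ] H) (t : ℝ≥0) : H →L[ℂ] H :=
  if t = 0 then 1 else cfc (decay t) R

namespace IsNegResolvent

variable {R : H →L[ℂ] H} (hR : IsNegResolvent A R)
include hR

theorem inner_nonneg (w : H) : 0 ≤ (⟪R w, w⟫_ℂ).re := (sq_nonneg _).trans (hR.norm_sq_le w)

theorem norm_apply_le (w : H) : ‖R w‖ ≤ ‖w‖ := by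
  have h1 := hR.norm_sq_le w
  have h2 : (⟪R w, w⟫_ℂ).re ≤ ‖R w‖ * ‖w‖ := (Complex.re_le_norm _).trans (norm_inner_le_norm _ _)
  by_contra! h
  nlinarith [norm_nonneg w]

theorem spectrum_subset : _root_.spectrum ℝ R ⊆ Set.Icc 0 1 := by
  intro x hx
  have hpos : 0 ≤ R := by
    rw [ContinuousLinearMap.nonneg_iff_isPositive, ContinuousLinearMap.isPositive_def']
    exact ⟨hR.isSelfAdjoint, hR.inner_nonneg⟩
  have hn : ‖R‖ ≤ 1 := R.opNorm_le_bound zero_le_one fun w => by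
    simpa using hR.norm_apply_le w
  exact ⟨spectrum_nonneg_of_nonneg hpos hx,
    (le_abs_self x).trans ((spectrum.norm_le_norm_mul_of_mem hx).trans
      (mul_le_one₀ hn (norm_nonneg _) ContinuousLinearMap.norm_id_le))⟩

theorem injective : Function.Injective R := by
  rw [injective_iff_map_eq_zero]
  intro w hw
  have h : ((0 : H), -w) ∈ A.graph := (hR.mem_graph _ _).2 (by simpa using hw)
  simpa using A.graph_fst_eq_zero_snd h rfl

theorem denseRange : DenseRange R := by
  have h : (LinearMap.range (R : H →ₗ[ℂ] H))ᗮ = ⊥ := by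
    rw [ContinuousLinearMap.orthogonal_range, hR.isSelfAdjoint.adjoint_eq]
    exact LinearMap.ker_eq_bot.2 hR.injective
  rw [← Submodule.topologicalClosure_eq_top_iff, ← Submodule.dense_iff_topologicalClosure_eq_top] at h
  exact h

theorem mem_domain_iff {x : H} : x ∈ A.domain ↔ x ∈ Set.range R := by
  rw [A.mem_domain_iff]
  constructor
  · rintro ⟨y, hy⟩
    exact ⟨_, (hR.mem_graph _ _).1 hy⟩
  · rintro ⟨w, rfl⟩
    exact ⟨R w - w, (hR.mem_graph _ _).2 (by simp)⟩

theorem dense_domain : Dense (A.domain : Set H) :=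
  hR.denseRange.mono fun _ hx => hR.mem_domain_iff.2 hx

theorem norm_semigroup_le (t : ℝ≥0) : ‖semigroup R t‖ ≤ 1 := by
  rw [semigroup]
  split_ifs with ht
  · exact ContinuousLinearMap.norm_id_le
  · refine norm_cfc_le zero_le_one fun x hx => ?_
    obtain ⟨h0, h1⟩ := hR.spectrum_subset hx
    rw [Real.norm_of_nonneg (decay_nonneg _ _)]
    exact decay_le_one (by positivity) h0 h1

theorem semigroup_add (s t : ℝ≥0) :
    semigroup R (s + t) = semigroup R s * semigroup R t := by
  by_cases hs : s = 0
  · simp [hs, semigroup]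
  by_cases ht : t = 0
  · simp [ht, semigroup]
  rw [semigroup, semigroup, semigroup, if_neg hs, if_neg ht, if_neg (by simp [hs]),
    ← cfc_mul _ _ _ (continuous_decay _).continuousOn (continuous_decay _).continuousOn]
  refine cfc_congr fun x hx => ?_
  rw [NNReal.coe_add]
  exact decay_add (by positivity) (by positivity) (hR.spectrum_subset hx).1

theorem semigroup_sub_one_mul {t : ℝ≥0} (ht : t ≠ 0) :
    (semigroup R t - 1) * R = cfc (fun x : ℝ => (decay t x - 1) * x) R := by
  have := hR.isSelfAdjoint
  have hc := (continuous_decay t).continuousOn (s := _root_.spectrum ℝ R)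
  rw [semigroup, if_neg ht, cfc_mul (fun x => decay t x - 1) (fun x => x) R
    (hc.sub continuousOn_const) continuousOn_id, cfc_sub _ _ R hc continuousOn_const,
    cfc_const_one ℝ R, cfc_id' ℝ R]

/-- The quantitative form of `exp (t A) x → x` for `x` in the domain of `A`. -/
theorem norm_semigroup_sub_one_mul_le (t : ℝ≥0) : ‖(semigroup R t - 1) * R‖ ≤ t := by
  by_cases ht : t = 0
  · simp [ht, semigroup]
  rw [hR.semigroup_sub_one_mul ht]
  refine norm_cfc_le t.2 fun x hx => ?_
  obtain ⟨h0, h1⟩ := hR.spectrum_subset hx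
  have ht' : (0 : ℝ) < t := by positivity
  have h2 := one_sub_decay_mul_le ht' h0 h1
  have h3 := decay_le_one ht' h0 h1
  rw [Real.norm_eq_abs, abs_le]
  constructor <;> nlinarith

/-- The quantitative form of `t⁻¹ (exp (t A) - 1) R w → A R w = (R - 1) w` for `w` in the range of
`R`. The second factor `R` is needed: there is no uniform estimate near the point `0` of the spectrum
of `R`. -/
theorem norm_quotient_mul_le {t : ℝ≥0} (ht : t ≠ 0) :
    ‖((t : ℝ)⁻¹ • ((semigroup R t - 1) * R) - (R - 1)) * R‖ ≤ t := by
  have := hR.isSelfAdjoint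
  have hc := (continuous_decay t).continuousOn (s := _root_.spectrum ℝ R)
  have hc' : ContinuousOn (fun x : ℝ => (decay t x - 1) * x) (_root_.spectrum ℝ R) :=
    (hc.sub continuousOn_const).mul continuousOn_id
  have hc'' : ContinuousOn (fun x : ℝ => (t : ℝ)⁻¹ * ((decay t x - 1) * x))
      (_root_.spectrum ℝ R) := continuousOn_const.mul hc'
  have e : ((t : ℝ)⁻¹ • ((semigroup R t - 1) * R) - (R - 1)) * R
      = cfc (fun x : ℝ => ((t : ℝ)⁻¹ * ((decay t x - 1) * x) - (x - 1)) * x) R := by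
    rw [cfc_mul (fun x : ℝ => (t : ℝ)⁻¹ * ((decay t x - 1) * x) - (x - 1)) (fun x => x) R
      (hc''.sub (by fun_prop)) continuousOn_id,
      cfc_sub (fun x : ℝ => (t : ℝ)⁻¹ * ((decay t x - 1) * x)) (fun x => x - 1) R hc'' (by fun_prop),
      cfc_const_mul _ _ R hc', cfc_sub (fun x : ℝ => x) (fun _ => 1) R (by fun_prop) (by fun_prop),
      cfc_const_one ℝ R, cfc_id' ℝ R, hR.semigroup_sub_one_mul ht]
  rw [e]
  refine norm_cfc_le t.2 fun x hx => ?_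
  obtain ⟨h0, h1⟩ := hR.spectrum_subset hx
  exact abs_decay_quotient_le (by positivity) h0 h1

theorem tendsto_semigroup_zero (y : H) : Tendsto (fun t => semigroup R t y) (𝓝 0) (𝓝 y) := by
  have h := tendsto_apply_zero_of_denseRange (l := 𝓝 (0 : ℝ≥0)) (F := fun t => semigroup R t - 1)
    (C := 2) (b := fun t => (t : ℝ)) hR.denseRange (NNReal.continuous_coe.tendsto' _ _ rfl)
    (.of_forall fun t => (norm_sub_le _ _).trans ?_) (.of_forall fun t w => ?_) y
  · simpa using h.add_const y
  · have := hR.norm_semigroup_le t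
    have h1 : ‖(1 : H →L[ℂ] H)‖ ≤ 1 := ContinuousLinearMap.norm_id_le
    linarith
  · exact (((semigroup R t - 1) * R).le_opNorm w).trans
      (by gcongr; exact hR.norm_semigroup_sub_one_mul_le t)

theorem continuous_semigroup (x : H) : Continuous fun t => semigroup R t x := by
  have key : ∀ s t : ℝ≥0, s ≤ t →
      dist (semigroup R t x) (semigroup R s x) ≤ ‖semigroup R (nndist t s) x - x‖ := by
    intro s t hst
    have e : t = s + nndist t s := by
      ext
      rw [NNReal.coe_add, coe_nndist, NNReal.dist_eq, abs_of_nonneg (by simpa using hst)]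
      ring
    have e' : semigroup R t x = semigroup R s (semigroup R (nndist t s) x) := by
      conv_lhs => rw [e, hR.semigroup_add]
      rfl
    rw [e', dist_eq_norm, ← map_sub]
    exact (ContinuousLinearMap.le_of_opNorm_le _ (hR.norm_semigroup_le s) _).trans_eq (one_mul _)
  have key' : ∀ s t : ℝ≥0,
      dist (semigroup R t x) (semigroup R s x) ≤ ‖semigroup R (nndist t s) x - x‖ := by
    intro s t
    rcases le_total s t with h | h
    · exact key s t h
    · rw [dist_comm, nndist_comm]
      exact key t s h
  rw [continuous_iff_continuousAt]
  intro s
  refine tendsto_iff_dist_tendsto_zero.2 (squeeze_zero (fun _ => dist_nonneg) (key' s) ?_)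
  have h1 : Tendsto (fun t : ℝ≥0 => nndist t s) (𝓝 s) (𝓝 0) :=
    (continuous_id.nndist continuous_const).tendsto' _ _ (nndist_self s)
  have h2 := (((hR.tendsto_semigroup_zero x).sub_const x).norm).comp h1
  rw [sub_self, norm_zero] at h2
  exact h2

theorem tendsto_quotient (w : H) :
    Tendsto (fun t : ℝ≥0 => (t : ℝ)⁻¹ • (semigroup R t (R w) - R w)) (𝓝[≠] 0)
      (𝓝 (R w - w)) := by
  have hne : ∀ᶠ t : ℝ≥0 in 𝓝[≠] 0, t ≠ 0 := self_mem_nhdsWithin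
  have h := tendsto_apply_zero_of_denseRange (l := 𝓝[≠] (0 : ℝ≥0))
    (F := fun t : ℝ≥0 => (t : ℝ)⁻¹ • ((semigroup R t - 1) * R) - (R - 1))
    (C := 1 + (‖R‖ + ‖(1 : H →L[ℂ] H)‖)) (b := fun t => (t : ℝ)) hR.denseRange
    ((NNReal.continuous_coe.tendsto' _ _ rfl).mono_left nhdsWithin_le_nhds) ?_ ?_ w
  · simpa using h.add_const (R w - w)
  · filter_upwards [hne] with t ht
    refine (norm_sub_le _ _).trans (add_le_add ?_ (norm_sub_le _ _))
    rw [norm_smul, norm_inv, NNReal.norm_eq, inv_mul_le_iff₀ (by positivity), mul_one]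
    exact hR.norm_semigroup_sub_one_mul_le t
  · filter_upwards [hne] with t ht w
    exact ((((t : ℝ)⁻¹ • ((semigroup R t - 1) * R) - (R - 1)) * R).le_opNorm w).trans
      (by gcongr; exact hR.norm_quotient_mul_le ht)

theorem isExponential : IsExponential A (semigroup R) where
  zero := by simp [semigroup]
  add := hR.semigroup_add
  continuous := hR.continuous_semigroup
  generator x y := by
    constructor
    · intro h
      have := hR.tendsto_quotient (x - y)
      rw [(hR.mem_graph x y).1 h, sub_sub_cancel] at this
      exact this
    · intro h
      -- The generator is dissipative and extends `A`, while `1 - A` is already surjective.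
      let z := x - R (x - y)
      have hz : Tendsto (fun t : ℝ≥0 => (t : ℝ)⁻¹ • (semigroup R t z - z)) (𝓝[≠] 0) (𝓝 z) := by
        have h1 := h.sub (hR.tendsto_quotient (x - y))
        rw [show y - (R (x - y) - (x - y)) = z by simp only [z]; abel] at h1
        refine h1.congr fun t => ?_
        rw [← smul_sub]
        simp only [z, map_sub]
        congr 1
        abel
      have h2 : Tendsto (fun t : ℝ≥0 => (⟪z, (t : ℝ)⁻¹ • (semigroup R t z - z)⟫_ℂ).re) (𝓝[≠] 0)
          (𝓝 (⟪z, z⟫_ℂ).re) :=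
        (Complex.continuous_re.tendsto _).comp (tendsto_const_nhds.inner hz)
      have h3 : (⟪z, z⟫_ℂ).re ≤ 0 := by
        refine le_of_tendsto h2 (.of_forall fun t => ?_)
        rw [RCLike.real_smul_eq_coe_smul (K := ℂ), inner_smul_right]
        refine (Complex.re_ofReal_mul _ _).trans_le (mul_nonpos_of_nonneg_of_nonpos (by positivity) ?_)
        have h4 : (⟪z, semigroup R t z⟫_ℂ).re ≤ ‖z‖ * ‖semigroup R t z‖ :=
          (Complex.re_le_norm _).trans (norm_inner_le_norm _ _)
        have h5 : ‖semigroup R t z‖ ≤ 1 * ‖z‖ :=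
          ContinuousLinearMap.le_of_opNorm_le _ (hR.norm_semigroup_le t) z
        have h6 : (⟪z, z⟫_ℂ).re = ‖z‖ ^ 2 := (norm_sq_eq_re_inner (𝕜 := ℂ) z).symm
        rw [inner_sub_right, Complex.sub_re]
        nlinarith [norm_nonneg z]
      have h4 : z = 0 := by
        have h6 : (⟪z, z⟫_ℂ).re = ‖z‖ ^ 2 := (norm_sq_eq_re_inner (𝕜 := ℂ) z).symm
        rw [h6] at h3
        simpa using le_antisymm h3 (by positivity)
      rw [hR.mem_graph]
      exact (sub_eq_zero.1 h4).symm

end IsNegResolvent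

end Semigroup

/-! ### Bounded resolvents and the spectral gap -/

section Gap

theorem isGLB_zero_iff {S : Set ℝ} (h0 : ∀ r ∈ S, 0 ≤ r) :
    IsGLB S 0 ↔ ∀ ε > 0, ∃ r ∈ S, r < ε := by
  constructor
  · intro h ε hε
    by_contra! hc
    exact hε.not_ge (h.2 hc)
  · refine fun h => ⟨h0, fun b hb => ?_⟩
    by_contra! hc
    obtain ⟨r, hr, hrb⟩ := h b hc
    exact hrb.not_ge (hb hr)

variable {H : Type*} [NormedAddCommGroup H] [InnerProductSpace ℂ H] {R : H →L[ℂ] H}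

theorem gap_of_isUnit_one_sub (h : IsUnit (1 - R)) : ∃ c > 0, ∀ w, c * ‖w‖ ≤ ‖w - R w‖ := by
  obtain ⟨Q, -, hQ⟩ := isUnit_iff_exists.1 h
  refine ⟨(‖Q‖ + 1)⁻¹, by positivity, fun w => ?_⟩
  have h1 : Q (w - R w) = w := DFunLike.congr_fun hQ w
  rw [inv_mul_le_iff₀ (by positivity)]
  calc ‖w‖ = ‖Q (w - R w)‖ := by rw [h1]
    _ ≤ ‖Q‖ * ‖w - R w‖ := Q.le_opNorm _
    _ ≤ (‖Q‖ + 1) * ‖w - R w‖ := by gcongr; linarith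

variable [CompleteSpace H] {A : H →ₗ.[ℂ] H}

namespace IsNegResolvent

theorem apply_sub_apply (hR : IsNegResolvent A R) (x : A.domain) : R (x - A x) = x :=
  (hR.mem_graph _ _).1 (A.mem_graph x)

theorem apply_mem_domain (hR : IsNegResolvent A R) (w : H) : R w ∈ A.domain :=
  hR.mem_domain_iff.2 ⟨w, rfl⟩

theorem apply_apply (hR : IsNegResolvent A R) (w : H) (h : R w ∈ A.domain) :
    A ⟨R w, h⟩ = R w - w := by
  have h1 := A.mem_graph ⟨R w, h⟩
  have h2 : (R w, R w - w) ∈ A.graph := (hR.mem_graph _ _).2 (by simp)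
  exact A.mem_graph_snd_inj h1 h2 rfl

theorem inner_apply_left (hR : IsNegResolvent A R) (x y : H) : ⟪R x, y⟫_ℂ = ⟪x, R y⟫_ℂ :=
  hR.isSelfAdjoint.isSymmetric x y

theorem mem_ker_iff (hR : IsNegResolvent A R) (x : H) :
    (∃ h : x ∈ A.domain, A ⟨x, h⟩ = 0) ↔ R x = x := by
  constructor
  · rintro ⟨h, h0⟩
    simpa [h0] using hR.apply_sub_apply ⟨x, h⟩
  · intro h
    have hx : R x ∈ A.domain := hR.apply_mem_domain x
    have := hR.apply_apply x hx
    simp only [h, sub_self] at this hx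
    exact ⟨hx, this⟩

/-- The resolvent set of `A`, in terms of bounded operators: `z - A = (1 - (1 - z) R) R⁻¹`. -/
theorem mem_resolventSet_iff (hR : IsNegResolvent A R) (z : ℂ) :
    z ∈ resolventSet A ↔ IsUnit (1 - (1 - z) • R) := by
  constructor
  · rintro ⟨G, h1, h2⟩
    refine isUnit_iff_exists.2 ⟨(1 - z) • G + 1, ?_, ?_⟩
    · ext x
      obtain ⟨h, hx⟩ := h1 x
      have h3 := hR.apply_sub_apply ⟨G x, h⟩
      have h4 : (1 - z) • G x + x = G x - A ⟨G x, h⟩ := by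
        nth_rw 2 [← hx]
        rw [sub_smul, one_smul]
        abel
      simp only [mul_apply_eq_comp, add_apply, sub_apply, smul_apply, one_apply_eq_self]
      rw [h4, h3]
      refine Eq.trans ?_ hx
      rw [sub_smul, one_smul]
      abel
    · ext w
      have h3 := h2 ⟨R w, hR.apply_mem_domain w⟩
      rw [hR.apply_apply] at h3
      have h4 : w - (1 - z) • R w = z • R w - (R w - w) := by
        rw [sub_smul, one_smul]
        abel
      simp only [mul_apply_eq_comp, add_apply, sub_apply, smul_apply, one_apply_eq_self]
      rw [h4, h3, ← h4]
      abel
  · intro h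
    obtain ⟨G, h1, h2⟩ := isUnit_iff_exists.1 h
    refine ⟨R * G, fun x => ⟨hR.apply_mem_domain _, ?_⟩, fun x => ?_⟩
    · have h3 : G x - (1 - z) • R (G x) = x := DFunLike.congr_fun h1 x
      simp only [mul_apply_eq_comp]
      rw [hR.apply_apply]
      nth_rw 4 [← h3]
      rw [sub_smul, one_smul]
      abel
    · obtain ⟨w, hw⟩ := hR.mem_domain_iff.1 x.2
      obtain rfl : ⟨R w, hR.apply_mem_domain w⟩ = x := Subtype.ext hw
      have h3 : G (w - (1 - z) • R w) = w := DFunLike.congr_fun h2 w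
      rw [hR.apply_apply, mul_apply_eq_comp]
      congr 1
      nth_rw 5 [← h3]
      congr 1
      rw [sub_smul, one_smul]
      abel

variable {N : Submodule ℂ H}

theorem apply_mem_orthogonal (hR : IsNegResolvent A R) (hN : ∀ x, x ∈ N ↔ R x = x) {w : H}
    (hw : w ∈ Nᗮ) : R w ∈ Nᗮ := by
  intro n hn
  rw [← hR.inner_apply_left, (hN n).1 hn]
  exact hw n hn

theorem mem_orthogonal_of_apply (hR : IsNegResolvent A R) (hN : ∀ x, x ∈ N ↔ R x = x) {w : H}
    (hw : R w ∈ Nᗮ) : w ∈ Nᗮ := by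
  intro n hn
  rw [← (hN n).1 hn, hR.inner_apply_left]
  exact hw n hn

/-- The restriction of `A` to the orthogonal complement of its kernel is again a nonpositive
self-adjoint operator, and its resolvent is the restriction of `R`. -/
theorem restrict_orthogonal (hR : IsNegResolvent A R) (hN : ∀ x, x ∈ N ↔ R x = x) :
    IsNegResolvent (restrict A Nᗮ)
      ((R.comp Nᗮ.subtypeL).codRestrict Nᗮ fun w => hR.apply_mem_orthogonal hN w.2) where
  isSelfAdjoint := by
    rw [ContinuousLinearMap.isSelfAdjoint_iff_isSymmetric]
    exact fun x y => hR.inner_apply_left x y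
  norm_sq_le w := hR.norm_sq_le w
  mem_graph x y := by
    rw [LinearPMap.mem_graph_iff]
    constructor
    · rintro ⟨⟨_, h1, h2⟩, rfl, rfl⟩
      exact Subtype.ext (hR.apply_sub_apply ⟨_, h1⟩)
    · intro h
      have h' : R (x - y : H) = x := congrArg Subtype.val h
      obtain ⟨v, hv, hy⟩ := (LinearPMap.mem_graph_iff _).1 ((hR.mem_graph _ _).2 h')
      obtain ⟨v, hvd⟩ := v
      obtain rfl : v = x := hv
      have hy : A ⟨x, hvd⟩ = y := hy
      exact ⟨⟨x, hvd, hy ▸ y.2⟩, rfl, Subtype.ext hy⟩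

end IsNegResolvent

variable {N : Submodule ℂ H}

/-- Gaplessness of `A` on `Nᗮ` means that `1 - R` is not bounded below there. With `φ = R w` one has
`A φ = -(w - R w)` and `‖φ‖ ≤ ‖w‖ ≤ ‖φ‖ + ‖A φ‖`. -/
theorem isGLB_norm_quotient_iff (hR : IsNegResolvent A R) (hN : ∀ x, x ∈ N ↔ R x = x) :
    IsGLB {r : ℝ | ∃ φ : A.domain, (φ : H) ∈ Nᗮ ∧ φ ≠ 0 ∧ r = ‖A φ‖ / ‖φ‖} 0 ↔
      ¬ ∃ c > 0, ∀ w ∈ Nᗮ, c * ‖w‖ ≤ ‖w - R w‖ := by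
  rw [isGLB_zero_iff (by rintro _ ⟨φ, -, -, rfl⟩; positivity)]
  constructor
  · rintro h ⟨c, hc, hw⟩
    obtain ⟨_, ⟨φ, hφ, hφ0, rfl⟩, hr⟩ := h c hc
    have h0 : 0 < ‖φ‖ := norm_pos_iff.2 hφ0
    have h1 := hR.apply_sub_apply φ
    have h2 := hw (φ - A φ) (hR.mem_orthogonal_of_apply hN (by rwa [h1]))
    have h3 := hR.norm_apply_le (φ - A φ)
    rw [h1, sub_sub_cancel_left, norm_neg] at h2
    rw [h1] at h3
    rw [div_lt_iff₀ h0] at hr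
    exact hr.not_ge (le_trans (by gcongr; exact h3) h2)
  · intro h ε hε
    by_contra! hc
    refine h ⟨(1 + ε⁻¹)⁻¹, by positivity, fun w hw => ?_⟩
    have h1 : ε * ‖R w‖ ≤ ‖w - R w‖ := by
      rcases eq_or_ne (R w) 0 with h0 | h0
      · simp [h0]
      · have := hc _ ⟨⟨R w, hR.apply_mem_domain w⟩, hR.apply_mem_orthogonal hN hw,
          fun h => h0 (congrArg Subtype.val h), rfl⟩
        rw [hR.apply_apply, norm_sub_rev] at this
        exact (le_div_iff₀ (norm_pos_iff.2 h0)).1 this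
    have h2 : ‖w‖ ≤ ‖w - R w‖ + ‖R w‖ := by simpa using norm_add_le (w - R w) (R w)
    rw [inv_mul_le_iff₀ (by positivity), add_mul, one_mul]
    have h3 : ‖R w‖ ≤ ε⁻¹ * ‖w - R w‖ := by rwa [le_inv_mul_iff₀ hε]
    linarith

/-- The inequality `⟪φ, exp (t A) φ⟫ ≥ ‖φ‖² + t ⟪φ, A φ⟫`, which is `exp (-t s) ≥ 1 - t s` for the
points `-s` of the spectrum of `A`. With `φ = R w` it becomes positivity of a function of `R`. -/
theorem le_re_inner_semigroup (hR : IsNegResolvent A R) {t : ℝ≥0} (ht : t ≠ 0) (φ : A.domain) :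
    ‖(φ : H)‖ ^ 2 - t * quadForm A φ ≤ (⟪(φ : H), semigroup R t φ⟫_ℂ).re := by
  have := hR.isSelfAdjoint
  obtain ⟨w, hw⟩ := hR.mem_domain_iff.1 φ.2
  obtain rfl : ⟨R w, hR.apply_mem_domain w⟩ = φ := Subtype.ext hw
  have hc := (continuous_decay t).continuousOn (s := _root_.spectrum ℝ R)
  have hc' : ContinuousOn (fun x : ℝ => (decay t x - 1) * x) (_root_.spectrum ℝ R) :=
    (hc.sub continuousOn_const).mul continuousOn_id
  have e : R * ((semigroup R t - 1) * R + (t : ℝ) • (1 - R))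
      = cfc (fun x : ℝ => x * ((decay t x - 1) * x + t * (1 - x))) R := by
    rw [cfc_mul (fun x : ℝ => x) (fun x => (decay t x - 1) * x + t * (1 - x)) R continuousOn_id
      (hc'.add (by fun_prop)),
      cfc_add R (fun x : ℝ => (decay t x - 1) * x) (fun x => t * (1 - x)) hc' (by fun_prop),
      cfc_const_mul (t : ℝ) (fun x => 1 - x) R (by fun_prop),
      cfc_sub (fun _ : ℝ => 1) (fun x => x) R (by fun_prop) (by fun_prop), cfc_const_one ℝ R,
      cfc_id' ℝ R, hR.semigroup_sub_one_mul ht]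
  have hpos : 0 ≤ R * ((semigroup R t - 1) * R + (t : ℝ) • (1 - R)) := by
    rw [e]
    refine cfc_nonneg fun x hx => ?_
    obtain ⟨h0, h1⟩ := hR.spectrum_subset hx
    have := one_sub_decay_mul_le (t := t) (by positivity) h0 h1
    exact mul_nonneg h0 (by linarith)
  rw [ContinuousLinearMap.nonneg_iff_isPositive] at hpos
  have h1 : 0 ≤ (⟪w, _⟫_ℂ).re := hpos.re_inner_nonneg_right w
  simp only [mul_apply_eq_comp, add_apply, sub_apply, smul_apply, one_apply_eq_self] at h1
  rw [← hR.inner_apply_left, inner_add_right, inner_sub_right, RCLike.real_smul_eq_coe_smul (K := ℂ),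
    inner_smul_right, Complex.add_re, Complex.sub_re] at h1
  have h2 : (⟪R w, R w⟫_ℂ).re = ‖R w‖ ^ 2 := (norm_sq_eq_re_inner (𝕜 := ℂ) _).symm
  have h3 : (((t : ℝ) : ℂ) * ⟪R w, w - R w⟫_ℂ).re = t * (⟪R w, w - R w⟫_ℂ).re :=
    Complex.re_ofReal_mul _ _
  have h4 : quadForm A ⟨R w, hR.apply_mem_domain w⟩ = (⟪R w, w - R w⟫_ℂ).re := by
    rw [quadForm, hR.apply_apply, ← neg_sub w, inner_neg_right, Complex.neg_re, neg_neg]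
  rw [h4]
  rw [h2] at h1
  change 0 ≤ _ + (((t : ℝ) : ℂ) * ⟪R w, w - R w⟫_ℂ).re at h1
  rw [h3] at h1
  change ‖R w‖ ^ 2 - _ ≤ (⟪R w, semigroup R t (R w)⟫_ℂ).re
  linarith

/-- The inequality `‖exp (A / 2) φ‖² = ⟪φ, exp (A) φ⟫ ≤ ⟪φ, (1 - A)⁻¹ φ⟫`, which is
`exp (-s) ≤ (1 + s)⁻¹` for the points `-s` of the spectrum of `A`. -/
theorem norm_semigroup_half_sq_le (hR : IsNegResolvent A R) (φ : H) :
    ‖semigroup R (1 / 2) φ‖ ^ 2 ≤ (⟪φ, R φ⟫_ℂ).re := by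
  have := hR.isSelfAdjoint
  have h1 : semigroup R 1 ≤ R := by
    conv_rhs => rw [← cfc_id' ℝ R]
    rw [semigroup, if_neg one_ne_zero]
    refine cfc_mono (fun x hx => ?_) (continuous_decay _).continuousOn continuousOn_id
    obtain ⟨h0, h1⟩ := hR.spectrum_subset hx
    exact decay_one_le h0 h1
  have h2 : IsSelfAdjoint (semigroup R (1 / 2)) := by
    rw [semigroup, if_neg (by norm_num)]
    exact cfc_predicate _ _
  have h3 : (⟪φ, semigroup R 1 φ⟫_ℂ).re = ‖semigroup R (1 / 2) φ‖ ^ 2 := by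
    have h4 : semigroup R 1 = semigroup R (1 / 2) * semigroup R (1 / 2) := by
      rw [← hR.semigroup_add, add_halves]
    rw [h4, mul_apply_eq_comp]
    have h5 := h2.isSymmetric φ (semigroup R (1 / 2) φ)
    exact (congrArg Complex.re h5).symm.trans (norm_sq_eq_re_inner (𝕜 := ℂ) _).symm
  have h4 : 0 ≤ (⟪φ, (R - semigroup R 1) φ⟫_ℂ).re :=
    ((ContinuousLinearMap.le_def _ _).1 h1).re_inner_nonneg_right φ
  rw [sub_apply, inner_sub_right, Complex.sub_re] at h4
  linarith

/-- A gap makes the semigroup contract strictly on `Nᗮ`: `‖exp (A / 2) φ‖² ≤ ⟪φ, R φ⟫`, and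
`R² ≤ R` turns the lower bound on `1 - R` into `⟪φ, R φ⟫ ≤ (1 - c²) ‖φ‖²`. -/
theorem not_isLUB_of_gap (hR : IsNegResolvent A R)
    (h : ∃ c > 0, ∀ w ∈ Nᗮ, c * ‖w‖ ≤ ‖w - R w‖) :
    ¬ IsLUB {r : ℝ | ∃ φ ∈ Nᗮ, φ ≠ 0 ∧ r = ‖semigroup R (1 / 2) φ‖ / ‖φ‖} 1 := by
  obtain ⟨c, hc, hw⟩ := h
  intro hlub
  have h1 : (1 : ℝ) ≤ √(1 - c ^ 2) := by
    refine hlub.2 ?_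
    rintro _ ⟨φ, hφ, hφ0, rfl⟩
    have h0 : 0 < ‖φ‖ := norm_pos_iff.2 hφ0
    refine (le_abs_self _).trans (Real.abs_le_sqrt ?_)
    rw [div_pow, div_le_iff₀ (by positivity)]
    refine (norm_semigroup_half_sq_le hR φ).trans ?_
    have h2 : (c * ‖φ‖) ^ 2 ≤ ‖φ - R φ‖ ^ 2 := pow_le_pow_left₀ (by positivity) (hw φ hφ) 2
    have h3 : ‖φ - R φ‖ ^ 2 = ‖φ‖ ^ 2 - 2 * (⟪φ, R φ⟫_ℂ).re + ‖R φ‖ ^ 2 :=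
      norm_sub_sq (𝕜 := ℂ) _ _
    have h4 := hR.norm_sq_le φ
    rw [hR.inner_apply_left] at h4
    nlinarith
  have h2 : √(1 - c ^ 2) < 1 := (Real.sqrt_lt' one_pos).2 (by nlinarith)
  linarith

theorem isUnit_one_sub_of_gap (hR : IsNegResolvent A R)
    (h : ∃ c > 0, ∀ w, c * ‖w‖ ≤ ‖w - R w‖) : IsUnit (1 - R) := by
  obtain ⟨c, hc, hw⟩ := h
  have hs : IsSelfAdjoint (1 - R) := (IsSelfAdjoint.one _).sub hR.isSelfAdjoint
  -- `(1 - R)²` is coercive.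
  have h2 : IsUnit ((1 - R) * (1 - R)) := by
    refine ContinuousLinearMap.isUnit_of_forall_le_norm_inner_map _ (c := ⟨c ^ 2, by positivity⟩)
      (by exact pow_pos hc 2) fun w => ?_
    have h1 : ⟪(1 - R) w, (1 - R) w⟫_ℂ = ⟪(1 - R) ((1 - R) w), w⟫_ℂ :=
      (hs.isSymmetric ((1 - R) w) w).symm
    rw [mul_apply_eq_comp, ← h1, inner_self_eq_norm_sq_to_K, norm_pow, RCLike.norm_ofReal, abs_norm]
    have h3 : (c * ‖w‖) ^ 2 ≤ ‖w - R w‖ ^ 2 := pow_le_pow_left₀ (by positivity) (hw w) 2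
    change ‖w‖ ^ 2 * c ^ 2 ≤ ‖w - R w‖ ^ 2
    linarith
  exact ((Commute.refl (1 - R)).isUnit_mul_iff.1 h2).1

theorem exists_ball_subset_resolventSet (hR : IsNegResolvent A R) (h : IsUnit (1 - R)) :
    ∃ ε > 0, ∀ z : ℂ, ‖z‖ < ε → z ∈ resolventSet A := by
  have hcont : Continuous fun z : ℂ => 1 - (1 - z) • R := by fun_prop
  have h1 : ∀ᶠ z : ℂ in 𝓝 0, IsUnit (1 - (1 - z) • R) :=
    hcont.continuousAt.eventually_mem (Units.isOpen.mem_nhds (by simpa using h))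
  obtain ⟨ε, hε, hb⟩ := Metric.eventually_nhds_iff.1 h1
  exact ⟨ε, hε, fun z hz => (hR.mem_resolventSet_iff z).2 (hb (by simpa using hz))⟩

/-- A nonpositive self-adjoint operator with trivial kernel does not have `0` as an isolated point
of its spectrum: a bump function at `1` of the resolvent would project onto the kernel. -/
theorem isUnit_one_sub_of_isolated (hR : IsNegResolvent A R) (hinj : ∀ w, R w = w → w = 0)
    {ε : ℝ} (hε : 0 < ε) (h : ∀ z : ℂ, z ≠ 0 → ‖z‖ < ε → z ∈ resolventSet A) :
    IsUnit (1 - R) := by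
  have := hR.isSelfAdjoint
  -- The point `x` of the spectrum of `R` corresponds to the point `1 - x⁻¹` of that of `A`.
  have hgap : ∀ x ∈ _root_.spectrum ℝ R, (1 + ε)⁻¹ < x → x = 1 := by
    intro x hx hxε
    by_contra hx1
    have hx0 : 0 < x := lt_trans (by positivity) hxε
    have hxlt : x < 1 := lt_of_le_of_ne (hR.spectrum_subset hx).2 hx1
    have h1 : 1 < x⁻¹ := (one_lt_inv₀ hx0).2 hxlt
    have h2 : x⁻¹ < 1 + ε := inv_lt_of_inv_lt₀ (by positivity) hxε
    have h3 := h ((1 - x⁻¹ : ℝ) : ℂ) (by exact_mod_cast (by linarith : 1 - x⁻¹ < 0).ne) (by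
      rw [Complex.norm_real, Real.norm_eq_abs, abs_lt]
      constructor <;> linarith)
    rw [hR.mem_resolventSet_iff] at h3
    refine _root_.spectrum.mem_iff.1 hx ?_
    have h4 : algebraMap ℝ (H →L[ℂ] H) x - R
        = algebraMap ℝ (H →L[ℂ] H) x * (1 - (1 - ((1 - x⁻¹ : ℝ) : ℂ)) • R) := by
      ext w
      rw [Algebra.algebraMap_eq_smul_one]
      change x • w - R w = x • (w - (1 - ((1 - x⁻¹ : ℝ) : ℂ)) • R w)
      rw [← Complex.coe_smul x w, ← Complex.coe_smul x (w - _), smul_sub, smul_smul]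
      congr 1
      have : (x : ℂ) * (1 - ((1 - x⁻¹ : ℝ) : ℂ)) = 1 := by
        push_cast
        have : (x : ℂ) ≠ 0 := by exact_mod_cast hx0.ne'
        field_simp
        ring
      rw [this, one_smul]
    rw [h4]
    exact ((IsUnit.mk0 x hx0.ne').map (algebraMap ℝ (H →L[ℂ] H))).mul h3
  let e : ℝ → ℝ := fun x => max 0 (x - (1 + ε)⁻¹)
  have he : Continuous e := by fun_prop
  have h1 : (1 - R) * cfc e R = 0 := by
    have h2 : cfc (fun x : ℝ => (1 - x) * e x) R = (1 - R) * cfc e R := by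
      rw [cfc_mul (fun x : ℝ => 1 - x) e R (by fun_prop) he.continuousOn,
        cfc_sub (fun _ : ℝ => 1) (fun x => x) R (by fun_prop) (by fun_prop), cfc_const_one ℝ R,
        cfc_id' ℝ R]
    rw [← h2, ← cfc_zero ℝ R]
    refine cfc_congr fun x hx => ?_
    rcases le_or_gt x (1 + ε)⁻¹ with hxε | hxε
    · simp [e, hxε]
    · simp [hgap x hx hxε]
  have h2 : cfc e R = 0 := by
    ext w
    have h3 : cfc e R w - R (cfc e R w) = 0 := DFunLike.congr_fun h1 w
    exact hinj _ (sub_eq_zero.1 h3).symm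
  by_contra hu
  have h3 : (1 : ℝ) ∈ _root_.spectrum ℝ R := by
    rw [_root_.spectrum.mem_iff, map_one]
    exact hu
  have h4 := norm_apply_le_norm_cfc e R h3 he.continuousOn
  rw [h2, norm_zero, norm_le_zero_iff] at h4
  have h5 : (1 + ε)⁻¹ < 1 := inv_lt_one_of_one_lt₀ (by linarith)
  have h6 : 1 - (1 + ε)⁻¹ ≤ e 1 := le_max_right _ _
  linarith

/-- The gaplessness criteria for a nonpositive self-adjoint operator `A` with kernel `N`. -/
theorem tfae_gapless (hR : IsNegResolvent A R)
    (hker : ∀ x, (∃ h : x ∈ A.domain, A ⟨x, h⟩ = 0) ↔ x ∈ N) :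
    List.TFAE [
      ∀ t : ℝ≥0, 0 < t → IsLUB {r : ℝ | ∃ φ ∈ Nᗮ, φ ≠ 0 ∧ r = ‖semigroup R t φ‖ / ‖φ‖} 1,
      IsGLB {r : ℝ | ∃ φ : A.domain, (φ : H) ∈ Nᗮ ∧ φ ≠ 0 ∧ r = ‖A φ‖ / ‖φ‖} 0,
      IsGLB {r : ℝ | ∃ φ : A.domain, (φ : H) ∈ Nᗮ ∧ φ ≠ 0 ∧
        r = quadForm A φ / (1 / 2 * ‖(φ : H)‖ ^ 2)} 0,
      ∀ ε : ℝ, 0 < ε → ∃ z ∈ spectrum (restrict A Nᗮ), z ≠ 0 ∧ ‖z‖ < ε] := by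
  have hN : ∀ x, x ∈ N ↔ R x = x := fun x => (hker x).symm.trans (hR.mem_ker_iff x)
  have hq : ∀ φ : A.domain, 0 ≤ quadForm A φ := fun φ => by
    have h1 := hR.norm_sq_le (φ - A φ)
    rw [hR.apply_sub_apply, inner_sub_right, Complex.sub_re,
      show (⟪(φ : H), (φ : H)⟫_ℂ).re = ‖(φ : H)‖ ^ 2 from
        (norm_sq_eq_re_inner (𝕜 := ℂ) _).symm] at h1
    rw [quadForm]
    linarith
  have hRK := hR.restrict_orthogonal hN
  tfae_have 1 → 2 := by
    intro h
    rw [isGLB_norm_quotient_iff hR hN]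
    exact fun hgap => not_isLUB_of_gap hR hgap (h (1 / 2) (by positivity))
  tfae_have 2 → 3 := by
    intro h
    rw [isGLB_zero_iff (by rintro _ ⟨φ, -, -, rfl⟩; positivity)] at h
    rw [isGLB_zero_iff (by rintro _ ⟨φ, -, -, rfl⟩; exact div_nonneg (hq φ) (by positivity))]
    intro ε hε
    obtain ⟨_, ⟨φ, hφ, hφ0, rfl⟩, hr⟩ := h (ε / 2) (by positivity)
    refine ⟨_, ⟨φ, hφ, hφ0, rfl⟩, ?_⟩
    have h0 : 0 < ‖(φ : H)‖ := norm_pos_iff.2 fun h => hφ0 (Subtype.ext h)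
    rw [div_lt_iff₀ (by exact h0)] at hr
    rw [div_lt_iff₀ (by positivity)]
    have h1 : quadForm A φ ≤ ‖(φ : H)‖ * ‖A φ‖ :=
      (neg_le_abs _).trans ((Complex.abs_re_le_norm _).trans (norm_inner_le_norm _ _))
    have h2 : ‖(φ : H)‖ * ‖A φ‖ < ‖(φ : H)‖ * (ε / 2 * ‖(φ : H)‖) := by gcongr; exact hr
    linarith
  tfae_have 3 → 1 := by
    intro h t ht
    rw [isGLB_zero_iff (by rintro _ ⟨φ, -, -, rfl⟩; exact div_nonneg (hq φ) (by positivity))] at h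
    constructor
    · rintro _ ⟨φ, -, hφ0, rfl⟩
      rw [div_le_one (norm_pos_iff.2 hφ0), ← one_mul ‖φ‖]
      exact ContinuousLinearMap.le_of_opNorm_le _ (hR.norm_semigroup_le t) φ
    · intro b hb
      refine le_of_forall_pos_le_add fun ε hε => ?_
      obtain ⟨_, ⟨φ, hφ, hφ0, rfl⟩, hr⟩ := h (2 * ε / t) (by positivity)
      have hφ0' : (φ : H) ≠ 0 := fun h => hφ0 (Subtype.ext h)
      have h0 : 0 < ‖(φ : H)‖ := norm_pos_iff.2 hφ0'
      have h1 := hb ⟨φ, hφ, hφ0', rfl⟩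
      rw [div_le_iff₀ h0] at h1
      rw [div_lt_iff₀ (by positivity), div_mul_eq_mul_div, lt_div_iff₀ (by exact ht)] at hr
      have h2 := le_re_inner_semigroup hR ht.ne' φ
      have h3 : (⟪(φ : H), semigroup R t φ⟫_ℂ).re ≤ ‖(φ : H)‖ * ‖semigroup R t φ‖ :=
        (Complex.re_le_norm _).trans (norm_inner_le_norm _ _)
      have h4 : ‖(φ : H)‖ * ‖semigroup R t φ‖ ≤ ‖(φ : H)‖ * (b * ‖(φ : H)‖) := by gcongr
      have h5 : 1 * ‖(φ : H)‖ ^ 2 ≤ (b + ε) * ‖(φ : H)‖ ^ 2 := by linarith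
      exact le_of_mul_le_mul_right h5 (by positivity)
  tfae_have 4 → 2 := by
    intro h
    rw [isGLB_norm_quotient_iff hR hN]
    rintro ⟨c, hc, hw⟩
    obtain ⟨ε, hε, hb⟩ := exists_ball_subset_resolventSet hRK
      (isUnit_one_sub_of_gap hRK ⟨c, hc, fun w => hw w w.2⟩)
    obtain ⟨z, hz, -, hzε⟩ := h ε hε
    exact hz (hb z hzε)
  tfae_have 2 → 4 := by
    intro h ε hε
    rw [isGLB_norm_quotient_iff hR hN] at h
    by_contra! hc
    obtain ⟨c, hc, hw⟩ := gap_of_isUnit_one_sub (isUnit_one_sub_of_isolated hRK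
      (fun w hw => by
        have h1 : (w : H) ∈ N := (hN w).2 (congrArg Subtype.val hw)
        have h2 := w.2 w h1
        exact Subtype.ext (inner_self_eq_zero.1 h2)) hε
      fun z hz hzε => by_contra fun hn => (hc z hn hz).not_gt hzε)
    exact h ⟨c, hc, fun w hw' => hw ⟨w, hw'⟩⟩
  tfae_finish

end Gap

/-! ### The free energy density -/

section Energy

variable {m α : ℝ} {β : Fin 4 → ℝ}

theorem energy_pos (m : ℝ) {p : Momentum} (hp : p ≠ 0) : 0 < fourMomentum m p 0 := by
  have : 0 < ‖p‖ := norm_pos_iff.2 hp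
  simp only [fourMomentum, Fin.cons_zero]
  positivity

theorem measurable_eqDist (m α : ℝ) (β : Fin 4 → ℝ) : Measurable (eqDist m α β) := by
  have h : ∀ ν, Measurable fun p : Momentum => fourMomentum m p ν := fun ν => by
    refine Fin.cases (measurable_energy m) (fun i => ?_) ν
    simp only [fourMomentum, Fin.cons_succ]
    fun_prop
  exact Real.measurable_exp.comp
    (measurable_const.add (Finset.measurable_sum _ fun ν _ => (h ν).const_mul _))

/-- The free energy density is half the squared norm. For `m = 0` the energy `p^0` vanishes at the
origin, which is a null set. -/
theorem infoCurrent_zero (φ : StateSpace m α β) : infoCurrent φ 0 = 1 / 2 * ‖φ‖ ^ 2 := by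
  have h1 : ‖φ‖ ^ 2 = ∫ p, ‖φ p‖ ^ 2 ∂eqMeasure m α β := by
    have h := L2.inner_def (𝕜 := ℂ) φ φ
    simp only [inner_self_eq_norm_sq_to_K] at h
    have h' : ((‖φ‖ ^ 2 : ℝ) : ℂ) = ∫ p, ((‖φ p‖ ^ 2 : ℝ) : ℂ) ∂eqMeasure m α β := by
      simpa using h
    rw [integral_complex_ofReal] at h'
    exact Complex.ofReal_injective h'
  have h2 : ∫ p, ‖φ p‖ ^ 2 ∂eqMeasure m α β
      = ∫ p, (ENNReal.ofReal (eqDist m α β p / (2 * Real.pi) ^ 3)).toReal • ‖φ p‖ ^ 2 :=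
    integral_withDensity_eq_integral_toReal_smul
      (((measurable_eqDist m α β).div_const _).ennreal_ofReal) (.of_forall fun _ => by simp) _
  rw [infoCurrent, h1, h2]
  congr 1
  refine integral_congr_ae ?_
  filter_upwards [Measure.ae_ne volume (0 : Momentum)] with p hp
  have h2 := (energy_pos m hp).ne'
  have h3 : 0 ≤ eqDist m α β p / (2 * Real.pi) ^ 3 :=
    div_nonneg (Real.exp_pos _).le (by positivity)
  rw [ENNReal.toReal_ofReal h3, smul_eq_mul]
  field_simp

end Energy

end Gapless

/-! ### The gaplessness criteria for the kinetic equation -/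

theorem theorem1 (m α : ℝ) (β : Fin 4 → ℝ) (hm : 0 ≤ m)
    (hβ₀ : β 0 < 0) (hβ : ∑ i : Fin 3, β i.succ ^ 2 < β 0 ^ 2)
    (L : Gapless.StateSpace m α β →ₗ.[ℂ] (Gapless.Momentum →ₘ[Gapless.eqMeasure m α β] ℂ))
    (hdense : Dense ((Gapless.generator L).domain : Set (Gapless.StateSpace m α β)))
    (hsymm : (Gapless.generator L).IsFormalAdjoint (Gapless.generator L))
    (hneg : Gapless.NegSemidef (Gapless.generator L))
    (A : Gapless.StateSpace m α β →ₗ.[ℂ] Gapless.StateSpace m α β)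
    (hA : A = Gapless.friedrichs (Gapless.generator L) hneg)
    (hker : ∀ φ : Gapless.StateSpace m α β,
      (∃ h : φ ∈ A.domain, A ⟨φ, h⟩ = 0) ↔ φ ∈ Gapless.hydro m α β) :
    ∃ U : ℝ≥0 → Gapless.StateSpace m α β →L[ℂ] Gapless.StateSpace m α β,
      Gapless.IsExponential A U ∧ (∀ V, Gapless.IsExponential A V → V = U) ∧
      List.TFAE [
        ∀ t : ℝ≥0, 0 < t →
          IsLUB {r : ℝ | ∃ φ ∈ Gapless.nonHydro m α β, φ ≠ 0 ∧ r = ‖U t φ‖ / ‖φ‖} 1,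
        IsGLB {r : ℝ | ∃ φ : A.domain, (φ : Gapless.StateSpace m α β) ∈ Gapless.nonHydro m α β ∧
          φ ≠ 0 ∧ r = ‖A φ‖ / ‖φ‖} 0,
        IsGLB {r : ℝ | ∃ φ : A.domain, (φ : Gapless.StateSpace m α β) ∈ Gapless.nonHydro m α β ∧
          φ ≠ 0 ∧ r = Gapless.entropyProduction A φ /
            Gapless.infoCurrent (φ : Gapless.StateSpace m α β) 0} 0,
        ∀ ε : ℝ, 0 < ε → ∃ z ∈ Gapless.spectrum (Gapless.restrict A (Gapless.nonHydro m α β)),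
          z ≠ 0 ∧ ‖z‖ < ε] := by
  subst hA
  obtain ⟨R, hR⟩ := Gapless.exists_isNegResolvent_friedrichs (Gapless.generator L) hneg hdense hsymm
  refine ⟨Gapless.semigroup R, hR.isExponential,
    fun V hV => hR.isExponential.unique hR.dense_domain hV, ?_⟩
  simp only [Gapless.infoCurrent_zero]
  exact Gapless.tfae_gapless hR hker
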